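/- Let $a,b$ be integers with $2\le a\le b-2$ and $(a,b)\neq(2,4)$, and let $\rho$ be a root of $f(x)=x^3-(a+b)x^2+abx-1$, so that $K=\mathbb Q(\rho)$ is a totally real cubic field with norm $N=N_{K/\mathbb Q}$. Call $\alpha\in K$ totally positive if $\sigma(\alpha)>0$ for every embedding $\sigma:K\to\mathbb R$, and call a totally positive $\alpha\in\mathbb Z[\rho]$ indecomposable in $\mathbb Z[\rho]$ if it is not the sum of two totally positive elements of $\mathbb Z[\rho]$. Write $b-a=2L+l_0$ with $L\in\mathbb Z$ and $l_0\in\{0,1\}$. If $\alpha$ is indecomposable in $\mathbb Z[\rho]$, then 1. $N(\alpha)\le L^2a^3+(2L^3+L^2+1)a^2-(2L^3+3L^2+L)a+L^3+L^2$ if $l_0=0$ and $1\le L\le a-2$; 2. $N(\alpha)\le (L^2+L)a^3+(2L^3+4L^2+3L+3)a^2-(2L^3+6L^2+5L+3)a+L^3+3L^2+2L+1$ if $l_0=1$ and $1\le L\le a+1$. -/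

import Mathlib

open Polynomial

/-- The polynomial `x ^ 3 - (a + b) x ^ 2 + a b x - 1` with integer coefficients. -/
noncomputable def thomasPoly (a b : ℤ) : ℤ[X] :=
  X ^ 3 - C (a + b) * X ^ 2 + C (a * b) * X - 1

/-- An element `α` of a field `K` is totally positive if `σ α > 0` for every embedding `σ` of `K`
into the real numbers. -/
def IsTotallyPositive {K : Type*} [Field K] (α : K) : Prop :=
  ∀ σ : K →+* ℝ, 0 < σ α

/-- `α` is an indecomposable element of the subring `O` of `K`: it is a totally positive element
of `O` that is not the sum of two totally positive elements of `O`. -/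
def IsIndecomposableIn {K : Type*} [Field K] (O : Subalgebra ℤ K) (α : K) : Prop :=
  α ∈ O ∧ IsTotallyPositive α ∧
    ¬ ∃ β ∈ O, ∃ γ ∈ O, IsTotallyPositive β ∧ IsTotallyPositive γ ∧ α = β + γ

/-!
Put `d = b - a` and `θ = ρ (ρ - a)`. Since `ρ (ρ - a) (ρ - b) = 1`, the elements `ρ` and
`η = (ρ - a) ^ 2` are totally positive units of `ℤ[ρ]`, and multiplying by them and their inverses
changes neither indecomposability nor the norm. Up to this action every totally positive element of
`ℤ[ρ]` lies in one of the two simplicial cones spanned by `1, ρ, ρ η` and by `1, η, ρ η`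
(`ThomasCubic.exists_mem_cone`). Instead of a topological argument for a fundamental domain, this is
a descent: the linear functional that equals `a` at `1`, `η` and `ρ η` is integral on `ℤ[ρ]` and
positive on totally positive elements (`ThomasCubic.height_pos`), so it attains a minimum on each
orbit, and finitely many linear inequalities satisfied by a minimal element place it in a translate
of one of the cones.

An indecomposable element of a simplicial cone spanned by totally positive units is one of these
units or lies in their half-open parallelepiped, because otherwise a generator could be subtracted.
The parallelepipeds have `d` and `a d` lattice points, which can be listed
(`ThomasCubic.coords_of_mem_cone_rho`, `ThomasCubic.coords_of_mem_cone_eta`). Apart from units, the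
candidates are `1 + j a + n θ - j ρ` with `0 ≤ j ≤ a - 1` and `1 ≤ n ≤ d`. Their norm
`ThomasCubic.parNorm` is a cubic polynomial in `j` and `n`, and the bounds are its values at
`j = a - 1`, `n = L + 1`. That these are maximal is proved for each `n` by expanding the cubic in `j`
in the Bernstein basis of `[0, a - 1]` (`ThomasCubic.parNorm_le_even`,
`ThomasCubic.parNorm_le_odd`).
-/

namespace ThomasCubic

/-! ### Maximizing the norm form over lattice points -/

/-- A cubic in `i` is nonnegative on `[0, M]`, `M = i + j`, if its Bernstein coefficients on that
interval are (here the middle ones are multiplied by `3`). -/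
theorem cubic_nonneg_of_bernstein {i j c₀ c₁ c₂ c₃ : ℤ} (hi : 0 ≤ i) (hj : 0 ≤ j)
    (h₀ : 0 ≤ c₀) (h₁ : 0 ≤ 3 * c₀ + (i + j) * c₁)
    (h₂ : 0 ≤ 3 * c₀ + 2 * (i + j) * c₁ + (i + j) ^ 2 * c₂)
    (h₃ : 0 ≤ c₀ + (i + j) * c₁ + (i + j) ^ 2 * c₂ + (i + j) ^ 3 * c₃) :
    0 ≤ c₀ + c₁ * i + c₂ * i ^ 2 + c₃ * i ^ 3 := by
  rcases (add_nonneg hi hj).eq_or_lt with h | h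
  · obtain rfl : i = 0 := by omega
    simpa using h₀
  · refine nonneg_of_mul_nonneg_right (a := (i + j) ^ 3) ?_ (by positivity)
    have : (i + j) ^ 3 * (c₀ + c₁ * i + c₂ * i ^ 2 + c₃ * i ^ 3) =
        j ^ 3 * c₀ + j ^ 2 * i * (3 * c₀ + (i + j) * c₁)
        + j * i ^ 2 * (3 * c₀ + 2 * (i + j) * c₁ + (i + j) ^ 2 * c₂)
        + i ^ 3 * (c₀ + (i + j) * c₁ + (i + j) ^ 2 * c₂ + (i + j) ^ 3 * c₃) := by ring
    rw [this]
    positivity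

/-- The norm of the lattice point `1 + j a + n ρ (ρ - a) - j ρ`, where `d = b - a`. -/
def parNorm (a d j n : ℤ) : ℤ :=
  1 + (a - d) * j + (a * d ^ 2 + a ^ 2 * d + 3) * j * n - (a * d + a ^ 2) * j * n ^ 2
    - a * d * j ^ 2 + (2 * a + d) * j ^ 2 * n - j ^ 3 + (a * d + d ^ 2) * n
    - (a + 2 * d) * n ^ 2 + n ^ 3

/-- The Bernstein criterion applied to the cubic `B - parNorm a d (a - 1 - i) n` in `i` on
`[0, a - 1]`. Once every constraint on `a`, `d`, `n` is encoded by writing these as polynomials in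
natural numbers, the conditions hold because all their coefficients are nonnegative. -/
theorem parNorm_le_of_bernstein {a d n B j : ℤ} (hj : 0 ≤ j) (hja : j ≤ a - 1) {c₀ c₁ c₂ : ℤ}
    (hc₀ : c₀ = B - parNorm a d (a - 1) n)
    (hc₁ : c₁ = a - d + (a * d ^ 2 + a ^ 2 * d + 3) * n - (a * d + a ^ 2) * n ^ 2
      + 2 * (a - 1) * ((2 * a + d) * n - a * d) - 3 * (a - 1) ^ 2)
    (hc₂ : c₂ = a * d - (2 * a + d) * n + 3 * (a - 1))
    (h₀ : 0 ≤ c₀) (h₁ : 0 ≤ 3 * c₀ + (a - 1) * c₁)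
    (h₂ : 0 ≤ 3 * c₀ + 2 * (a - 1) * c₁ + (a - 1) ^ 2 * c₂)
    (h₃ : 0 ≤ B - parNorm a d 0 n) :
    parNorm a d j n ≤ B := by
  have key := cubic_nonneg_of_bernstein (i := a - 1 - j) (j := j) (c₀ := c₀) (c₁ := c₁)
    (c₂ := c₂) (c₃ := -1) (by omega) hj h₀ (by simpa using h₁) (by simpa using h₂)
    (by rw [sub_add_cancel]; refine h₃.trans_eq ?_; subst hc₀ hc₁ hc₂; unfold parNorm; ring)
  have : B - parNorm a d j n = c₀ + c₁ * (a - 1 - j) + c₂ * (a - 1 - j) ^ 2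
      + -1 * (a - 1 - j) ^ 3 := by
    subst hc₀ hc₁ hc₂; unfold parNorm; ring
  omega

set_option maxHeartbeats 4000000 in
/-- The bound when `d = 2 L`; equality holds at `j = a - 1`, `n = L + 1`. -/
theorem parNorm_le_even {a L j n : ℤ} (hL : 1 ≤ L) (hLa : L ≤ a - 2) (hj : 0 ≤ j)
    (hja : j ≤ a - 1) (hn : 1 ≤ n) (hnd : n ≤ 2 * L) :
    parNorm a (2 * L) j n ≤
      L ^ 2 * a ^ 3 + (2 * L ^ 3 + L ^ 2 + 1) * a ^ 2 - (2 * L ^ 3 + 3 * L ^ 2 + L) * a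
        + L ^ 3 + L ^ 2 := by
  obtain ⟨p, rfl⟩ : ∃ p : ℕ, a = L + 2 + p := ⟨(a - L - 2).toNat, by omega⟩
  obtain h | rfl | h : n ≤ L ∨ n = L + 1 ∨ L + 2 ≤ n := by omega
  · obtain ⟨w, rfl⟩ : ∃ w : ℕ, n = L - w := ⟨(L - n).toNat, by omega⟩
    obtain ⟨q, rfl⟩ : ∃ q : ℕ, L = 1 + w + q := ⟨(L - w - 1).toNat, by omega⟩
    refine parNorm_le_of_bernstein hj hja rfl rfl rfl ?_ ?_ ?_ ?_ <;>
      (unfold parNorm; ring_nf; positivity)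
  · obtain ⟨q, rfl⟩ : ∃ q : ℕ, L = 1 + q := ⟨(L - 1).toNat, by omega⟩
    refine parNorm_le_of_bernstein hj hja rfl rfl rfl ?_ ?_ ?_ ?_ <;>
      (unfold parNorm; ring_nf; positivity)
  · obtain ⟨t, rfl⟩ : ∃ t : ℕ, n = L + 2 + t := ⟨(n - L - 2).toNat, by omega⟩
    obtain ⟨q, rfl⟩ : ∃ q : ℕ, L = 2 + t + q := ⟨(L - t - 2).toNat, by omega⟩
    refine parNorm_le_of_bernstein hj hja rfl rfl rfl ?_ ?_ ?_ ?_ <;>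
      (unfold parNorm; ring_nf; positivity)

set_option maxHeartbeats 4000000 in
/-- The bound when `d = 2 L + 1`; equality holds at `j = a - 1`, `n = L + 1`. -/
theorem parNorm_le_odd {a L j n : ℤ} (ha : 2 ≤ a) (hL : 1 ≤ L) (hLa : L ≤ a + 1) (hj : 0 ≤ j)
    (hja : j ≤ a - 1) (hn : 1 ≤ n) (hnd : n ≤ 2 * L + 1) :
    parNorm a (2 * L + 1) j n ≤
      (L ^ 2 + L) * a ^ 3 + (2 * L ^ 3 + 4 * L ^ 2 + 3 * L + 3) * a ^ 2
        - (2 * L ^ 3 + 6 * L ^ 2 + 5 * L + 3) * a + L ^ 3 + 3 * L ^ 2 + 2 * L + 1 := by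
  -- For `L ≤ 2` the binding constraint on `a` is `2 ≤ a`, for `3 ≤ L` it is `L - 1 ≤ a`.
  obtain h12 | hL : (L = 1 ∨ L = 2) ∨ 3 ≤ L := by omega
  · obtain ⟨p, rfl⟩ : ∃ p : ℕ, a = 2 + p := ⟨(a - 2).toNat, by omega⟩
    rcases h12 with rfl | rfl <;> norm_num at hnd <;> interval_cases n <;>
      refine parNorm_le_of_bernstein hj hja rfl rfl rfl ?_ ?_ ?_ ?_ <;>
      (unfold parNorm; ring_nf; positivity)
  obtain ⟨p, rfl⟩ : ∃ p : ℕ, a = L - 1 + p := ⟨(a - L + 1).toNat, by omega⟩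
  obtain h | h | h : (3 ≤ n ∧ n ≤ L) ∨ (L + 2 ≤ n ∧ n ≤ 2 * L - 1) ∨
      (n = 1 ∨ n = 2 ∨ n = L + 1 ∨ n = 2 * L ∨ n = 2 * L + 1) := by omega
  · obtain ⟨w, rfl⟩ : ∃ w : ℕ, n = L - w := ⟨(L - n).toNat, by omega⟩
    obtain ⟨q, rfl⟩ : ∃ q : ℕ, L = 3 + w + q := ⟨(L - w - 3).toNat, by omega⟩
    refine parNorm_le_of_bernstein hj hja rfl rfl rfl ?_ ?_ ?_ ?_ <;>
      (unfold parNorm; ring_nf; positivity)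
  · obtain ⟨t, rfl⟩ : ∃ t : ℕ, n = L + 2 + t := ⟨(n - L - 2).toNat, by omega⟩
    obtain ⟨q, rfl⟩ : ∃ q : ℕ, L = 3 + t + q := ⟨(L - t - 3).toNat, by omega⟩
    refine parNorm_le_of_bernstein hj hja rfl rfl rfl ?_ ?_ ?_ ?_ <;>
      (unfold parNorm; ring_nf; positivity)
  · obtain ⟨q, rfl⟩ : ∃ q : ℕ, L = 3 + q := ⟨(L - 3).toNat, by omega⟩
    rcases h with rfl | rfl | rfl | rfl | rfl <;>
      refine parNorm_le_of_bernstein hj hja rfl rfl rfl ?_ ?_ ?_ ?_ <;>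
      (unfold parNorm; ring_nf; positivity)

/-! ### Coordinates in `ℤ[ρ]` -/

/-- The element `m + n θ + k ρ`, where `θ = ρ (ρ - a)`. In the basis `1, θ, ρ` of `ℤ[ρ]` the units
`ρ`, `(ρ - a) ^ 2 = a ^ 2 + θ - a ρ` and `ρ (ρ - a) ^ 2 = 1 + (b - a) θ` have short coordinates. The
ring is left free, so that the conjugates of the element are instances of the same expression. -/
def elt {R : Type*} [CommRing R] (a : ℤ) (ρ : R) (m n k : ℤ) : R :=
  m + n * (ρ * (ρ - a)) + k * ρ

section Ring

variable {R : Type*} [CommRing R] {a b : ℤ} {ρ : R}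

theorem aeval_thomasPoly : aeval ρ (thomasPoly a b) = ρ * (ρ - a) * (ρ - b) - 1 := by
  simp [thomasPoly]; ring

theorem map_elt {S : Type*} [CommRing S] (σ : R →+* S) (m n k : ℤ) :
    σ (elt a ρ m n k) = elt a (σ ρ) m n k := by simp [elt]

theorem elt_sub (m n k m' n' k' : ℤ) :
    elt a ρ m n k - elt a ρ m' n' k' = elt a ρ (m - m') (n - n') (k - k') := by
  simp [elt]; ring

theorem rho_mul_elt (h : ρ * (ρ - a) * (ρ - b) = 1) (m n k : ℤ) :
    ρ * elt a ρ m n k = elt a ρ n (k + b * n) (m + a * k) := by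
  simp only [elt]; push_cast
  linear_combination (n : R) * h

theorem rho_sub_mul_elt (h : ρ * (ρ - a) * (ρ - b) = 1) (m n k : ℤ) :
    (ρ - a) * elt a ρ m n k = elt a ρ (n - a * m) (k + (b - a) * n) m := by
  simp only [elt]; push_cast
  linear_combination (n : R) * h

theorem rho_inv_mul_elt (h : ρ * (ρ - a) * (ρ - b) = 1) (m n k : ℤ) :
    (ρ - a) * (ρ - b) * elt a ρ m n k = elt a ρ (k - a * (n - b * m)) m (n - b * m) := by
  have e : elt a ρ m n k = ρ * elt a ρ (k - a * (n - b * m)) m (n - b * m) := by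
    rw [rho_mul_elt h]; congr 1 <;> ring
  rw [e]
  linear_combination elt a ρ (k - a * (n - b * m)) m (n - b * m) * h

theorem rho_sub_inv_mul_elt (h : ρ * (ρ - a) * (ρ - b) = 1) (m n k : ℤ) :
    ρ * (ρ - b) * elt a ρ m n k =
      elt a ρ k (m + a * k) (n - (b - a) * (m + a * k)) := by
  have e : elt a ρ m n k =
      (ρ - a) * elt a ρ k (m + a * k) (n - (b - a) * (m + a * k)) := by
    rw [rho_sub_mul_elt h]; congr 1 <;> ring
  rw [e]
  linear_combination elt a ρ k (m + a * k) (n - (b - a) * (m + a * k)) * h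

theorem elt_mul (h : ρ * (ρ - a) * (ρ - b) = 1) (m n k m' n' k' : ℤ) :
    elt a ρ m n k * elt a ρ m' n' k' =
      elt a ρ (m * m' + n * n' * (b - a) + n * k' + k * n')
        (m * n' + n * m' + n * n' * (b * (b - a)) + b * (n * k' + k * n') + k * k')
        (m * k' + k * m' + n * n' + a * (k * k')) := by
  simp only [elt]; push_cast
  linear_combination (n * n' * (ρ - a + b) + n * k' + k * n') * h

theorem mem_adjoin_iff (h : ρ * (ρ - a) * (ρ - b) = 1) {x : R} :
    x ∈ Algebra.adjoin ℤ {ρ} ↔ ∃ m n k, x = elt a ρ m n k := by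
  constructor
  · intro hx
    induction hx using Algebra.adjoin_induction with
    | mem x hx => exact ⟨0, 0, 1, by simp_all [elt]⟩
    | algebraMap r => exact ⟨r, 0, 0, by simp [elt]⟩
    | add x y _ _ hx hy =>
      obtain ⟨m, n, k, rfl⟩ := hx
      obtain ⟨m', n', k', rfl⟩ := hy
      exact ⟨m + m', n + n', k + k', by simp [elt]; ring⟩
    | mul x y _ _ hx hy =>
      obtain ⟨m, n, k, rfl⟩ := hx
      obtain ⟨m', n', k', rfl⟩ := hy
      exact ⟨_, _, _, elt_mul h ..⟩
  · rintro ⟨m, n, k, rfl⟩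
    have hρ : ρ ∈ Algebra.adjoin ℤ {ρ} := Algebra.self_mem_adjoin_singleton ℤ ρ
    have hi : ∀ z : ℤ, (z : R) ∈ Algebra.adjoin ℤ {ρ} := fun z => intCast_mem _ z
    exact add_mem (add_mem (hi m) (mul_mem (hi n) (mul_mem hρ (sub_mem hρ (hi a)))))
      (mul_mem (hi k) hρ)

end Ring

/-! ### Real embeddings and norms of `ℚ(ρ)` -/

theorem irreducible_map_thomasPoly {a b : ℤ} (ha : 2 ≤ a) (hab : a ≤ b - 2) :
    Irreducible ((thomasPoly a b).map (algebraMap ℤ ℚ)) ∧ (thomasPoly a b).Monic ∧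
      (thomasPoly a b).natDegree = 3 := by
  have hd : (thomasPoly a b).natDegree = 3 := by unfold thomasPoly; compute_degree!
  have hm : (thomasPoly a b).Monic := by unfold thomasPoly; monicity!
  refine ⟨?_, hm, hd⟩
  rw [← hm.irreducible_iff_irreducible_map_fraction_map,
    hm.irreducible_iff_roots_eq_zero_of_degree_le_three (by omega) (by omega)]
  refine Multiset.eq_zero_of_forall_notMem fun x hx => ?_
  have h0 : x * (x - a) * (x - b) = 1 := by
    have := aeval_thomasPoly (R := ℤ) (a := a) (b := b) (ρ := x)
    rw [coe_aeval_eq_eval, (mem_roots hm.ne_zero).1 hx |>.eq_zero] at this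
    simp at this; omega
  -- `x` and `x - b` are units of `ℤ` that differ by `b ≥ 4`.
  have h1 : x = 1 ∨ x = -1 := Int.isUnit_iff.1 (.of_mul_eq_one ((x - a) * (x - b)) (by linarith))
  have h2 : x - b = 1 ∨ x - b = -1 :=
    Int.isUnit_iff.1 (.of_mul_eq_one (x * (x - a)) (by linarith))
  omega

section Field

variable {K : Type*} [Field K] [NumberField K] {a b : ℤ} {ρ : K}

theorem minpoly_eq (ha : 2 ≤ a) (hab : a ≤ b - 2) (h : ρ * (ρ - a) * (ρ - b) = 1) :
    minpoly ℚ ρ = (thomasPoly a b).map (algebraMap ℤ ℚ) := by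
  obtain ⟨hi, hm, -⟩ := irreducible_map_thomasPoly ha hab
  refine (minpoly.eq_of_irreducible_of_monic hi ?_ (hm.map _)).symm
  rw [aeval_map_algebraMap, aeval_thomasPoly, h, sub_self]

theorem exists_powerBasis (hK : IntermediateField.adjoin ℚ {ρ} = ⊤) :
    ∃ pb : PowerBasis ℚ K, pb.gen = ρ :=
  ⟨.ofAdjoinEqTop (Algebra.IsIntegral.isIntegral ρ)
    ((IntermediateField.adjoin_simple_toSubalgebra_of_isAlgebraic
      (Algebra.IsAlgebraic.isAlgebraic ρ)).symm.trans (by rw [hK]; rfl)),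
    PowerBasis.ofAdjoinEqTop_gen ..⟩

/-- Every real root of the polynomial comes from an embedding of `K = ℚ(ρ)`. -/
theorem exists_ringHom (ha : 2 ≤ a) (hab : a ≤ b - 2) (h : ρ * (ρ - a) * (ρ - b) = 1)
    (hK : IntermediateField.adjoin ℚ {ρ} = ⊤) {r : ℝ} (hr : r * (r - a) * (r - b) = 1) :
    ∃ σ : K →+* ℝ, σ ρ = r := by
  obtain ⟨pb, hpb⟩ := exists_powerBasis hK
  have hy : aeval r (minpoly ℚ pb.gen) = 0 := by
    rw [hpb, minpoly_eq ha hab h, aeval_map_algebraMap, aeval_thomasPoly, hr, sub_self]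
  have hlift := pb.lift_gen r hy
  rw [hpb] at hlift
  exact ⟨pb.lift r hy, hlift⟩

theorem norm_elt (ha : 2 ≤ a) (hab : a ≤ b - 2) (h : ρ * (ρ - a) * (ρ - b) = 1)
    (hK : IntermediateField.adjoin ℚ {ρ} = ⊤) (m n k : ℤ) :
    Algebra.norm ℚ (elt a ρ m n k) =
      (m * ((m + n * (b * (b - a)) + b * k) * (m + a * k) - n * (k + b * n))
        - n * ((n * (b - a) + k) * (m + a * k) - n * n)
        + k * ((n * (b - a) + k) * (k + b * n) - n * (m + n * (b * (b - a)) + b * k)) : ℤ) := by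
  have hd : (minpoly ℚ ρ).natDegree = 3 := by
    obtain ⟨-, hm, hd⟩ := irreducible_map_thomasPoly ha hab
    rw [minpoly_eq ha hab h, hm.natDegree_map, hd]
  obtain ⟨pb, hpb⟩ := exists_powerBasis hK
  have hdim : pb.dim = 3 := by rw [← pb.natDegree_minpoly, hpb, hd]
  -- The determinant is taken in the basis `1, ρ, ρ ^ 2`.
  let B := pb.basis.reindex (finCongr hdim)
  have hB : ∀ i, B i = ρ ^ (i : ℕ) := fun i => by simp [B, hpb]
  have hM : Algebra.leftMulMatrix B (elt a ρ m n k) =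
      !![(m : ℚ), n, k + b * n;
        k - a * n, m - a * b * n, n - a * b * (k + b * n);
        n, k + b * n, m - a * b * n + (a + b) * (k + b * n)] := by
    apply (Matrix.toLin B B).injective
    rw [Algebra.leftMulMatrix_apply, Matrix.toLin_toMatrix]
    refine B.ext fun j => ?_
    rw [Matrix.toLin_self]
    fin_cases j <;> simp [Fin.sum_univ_three, hB, elt, Algebra.smul_def]
    · ring
    · linear_combination (n : K) * h
    · linear_combination (n * ρ + k + b * n : K) * h
  rw [Algebra.norm_eq_matrix_det B, hM, Matrix.det_fin_three]
  simp
  ring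

end Field

/-! ### A positive integral functional -/

/-- The integral linear functional with values `a` at the three units `1`, `(ρ - a) ^ 2` and
`ρ (ρ - a) ^ 2` is positive on totally positive elements: it is
`x ↦ Tr (x (ρ - b) (a ρ - 1) / f'(ρ))`, and `(ρ - b) (a ρ - 1) / f'(ρ)` is totally positive. The trace
formula is Lagrange interpolation of the quadratic remainder of `(X - b) (a X - 1) x(X)` modulo `f`,
whose leading coefficient is the value of the functional. -/
theorem height_pos {a b m n k : ℤ} {r : Fin 3 → ℝ}
    (hr : ∀ i, r i * (r i - a) * (r i - b) = 1) (h01 : r 0 < r 1)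
    (h0 : a * r 0 < 1) (h1 : 1 < a * r 1) (h2 : 1 < a * r 2) (h1b : r 1 < b) (h2b : b < r 2)
    (hpos : ∀ i, 0 < elt a (r i) m n k) : 0 < a * m + (a ^ 2 - 1) * k := by
  have key : ∀ i, (r i - b) * (a * r i - 1) * elt a (r i) m n k =
      (b * m + (a * k - n)) + (-(a * b + 1) * m + b * (k - a * n) + a * n - (a * k - n) * (a * b))
        * r i + (a * m + (a ^ 2 - 1) * k) * r i ^ 2 := fun i => by
    unfold elt
    linear_combination (a * n * r i + a * k - n) * hr i
  -- The three signs are those of `(r - b) (a r - 1) / f'(r)` at the three roots.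
  have g0 : 0 < (r 2 - r 1) * ((r 0 - b) * (a * r 0 - 1) * elt a (r 0) m n k) :=
    mul_pos (by linarith) (mul_pos (mul_pos_of_neg_of_neg (by linarith) (by linarith)) (hpos 0))
  have g1 : 0 < (r 2 - r 0) * ((b - r 1) * (a * r 1 - 1) * elt a (r 1) m n k) :=
    mul_pos (by linarith) (mul_pos (mul_pos (by linarith) (by linarith)) (hpos 1))
  have g2 : 0 < (r 1 - r 0) * ((r 2 - b) * (a * r 2 - 1) * elt a (r 2) m n k) :=
    mul_pos (by linarith) (mul_pos (mul_pos (by linarith) (by linarith)) (hpos 2))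
  have hV : 0 < (r 1 - r 0) * (r 2 - r 0) * (r 2 - r 1) :=
    mul_pos (mul_pos (by linarith) (by linarith)) (by linarith)
  have : (0 : ℝ) < a * m + (a ^ 2 - 1) * k := by
    refine pos_of_mul_pos_right (a := (r 1 - r 0) * (r 2 - r 0) * (r 2 - r 1)) ?_ hV.le
    exact (add_pos (add_pos g0 g1) g2).trans_eq (by
      linear_combination (r 2 - r 1) * key 0 - (r 2 - r 0) * key 1 + (r 1 - r 0) * key 2)
  exact_mod_cast this

/-- The polynomial has three real roots: one in `(0, 1 / a)`, one in `(1 / a, a)` and one in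
`(b, b + 1)`. -/
theorem exists_roots {a b : ℤ} (ha : 2 ≤ a) (hab : a ≤ b - 2) :
    ∃ r : Fin 3 → ℝ, (∀ i, r i * (r i - a) * (r i - b) = 1) ∧ r 0 < r 1 ∧
      a * r 0 < 1 ∧ 1 < a * r 1 ∧ 1 < a * r 2 ∧ r 1 < b ∧ b < r 2 := by
  have ha' : (2 : ℝ) ≤ a := by exact_mod_cast ha
  have hab' : (a : ℝ) ≤ b - 2 := by exact_mod_cast hab
  have hc : Continuous fun x : ℝ => x * (x - a) * (x - b) := by fun_prop
  have hinv : (a : ℝ)⁻¹ ≤ 2⁻¹ := by gcongr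
  have hinv0 : (0 : ℝ) < (a : ℝ)⁻¹ := by positivity
  have hmul : (a : ℝ) * (a : ℝ)⁻¹ = 1 := mul_inv_cancel₀ (by positivity)
  set c : ℝ := (a : ℝ)⁻¹
  have hcv : 1 < c * (c - a) * (c - b) := by
    have : c * (c - a) * (c - b) = (1 - c ^ 2) * (b - c) := by
      linear_combination (b - c) * hmul
    nlinarith
  obtain ⟨r0, ⟨h00, h0c⟩, hr0⟩ := intermediate_value_Ioo hinv0.le hc.continuousOn
    (show (1 : ℝ) ∈ Set.Ioo _ _ from ⟨by simp, hcv⟩)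
  obtain ⟨r1, ⟨h1c, h1a⟩, hr1⟩ := intermediate_value_Ioo' (show c ≤ a by linarith) hc.continuousOn
    (show (1 : ℝ) ∈ Set.Ioo _ _ from ⟨by simp, hcv⟩)
  obtain ⟨r2, ⟨h2b, -⟩, hr2⟩ := intermediate_value_Ioo (show (b : ℝ) ≤ b + 1 by linarith)
    hc.continuousOn (show (1 : ℝ) ∈ Set.Ioo _ _ from ⟨by simp, by nlinarith⟩)
  refine ⟨![r0, r1, r2], ?_, ?_⟩
  · intro i
    fin_cases i <;> simpa
  · simp only [Matrix.cons_val_zero, Matrix.cons_val_one, Matrix.cons_val]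
    refine ⟨by linarith, ?_, ?_, ?_, by linarith, h2b⟩ <;> nlinarith

/-! ### Reduction to two cones by totally positive units -/

/-- A set of coordinate triples that is stable under multiplication by `ρ`, `(ρ - a) ^ 2` and their
inverses, and on which the functional of `height_pos` is positive, contains an element of the cone
spanned by `1, ρ, ρ (ρ - a) ^ 2` or of the cone spanned by `1, (ρ - a) ^ 2, ρ (ρ - a) ^ 2`.

An element `x` of minimal height works, up to a unit. If it is not in the second cone, it lies beyond
one of its three facets. The unit `1`, `ρ` or `(ρ - a)⁻²` carries that facet to a facet of the first
cone. Minimality, compared with two units that send the remaining vertex of the first cone to a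
vertex of the second, bounds `x` by the other two facets of the first cone. -/
theorem exists_mem_cone {a b : ℤ} (ha : 2 ≤ a) (hab : a ≤ b - 2) {P : ℤ → ℤ → ℤ → Prop}
    (hρ : ∀ {m n k}, P m n k → P n (k + b * n) (m + a * k))
    (hρ' : ∀ {m n k}, P m n k → P (k - a * (n - b * m)) m (n - b * m))
    (hη : ∀ {m n k}, P m n k →
      P (k + (b - a) * n - a * (n - a * m)) (m + (b - a) * (k + (b - a) * n)) (n - a * m))
    (hη' : ∀ {m n k}, P m n k → P (n - (b - a) * (m + a * k))
      (k + a * (n - (b - a) * (m + a * k)))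
      (m + a * k - (b - a) * (k + a * (n - (b - a) * (m + a * k)))))
    (hpos : ∀ {m n k}, P m n k → 0 < a * m + (a ^ 2 - 1) * k)
    (hP : ∃ m n k, P m n k) :
    ∃ m n k, P m n k ∧ ((0 ≤ k ∧ 0 ≤ n ∧ n ≤ (b - a) * m) ∨
      (k ≤ 0 ∧ 0 ≤ a * n + k ∧ a * n + k ≤ (b - a) * a * (m + a * k))) := by
  classical
  have hex : ∃ t : ℕ, ∃ m n k, P m n k ∧ a * m + (a ^ 2 - 1) * k = t := by
    obtain ⟨m, n, k, h⟩ := hP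
    exact ⟨_, m, n, k, h, (Int.toNat_of_nonneg (hpos h).le).symm⟩
  obtain ⟨m, n, k, h, ht⟩ := Nat.find_spec hex
  have hmin : ∀ {m' n' k'}, P m' n' k' →
      a * m + (a ^ 2 - 1) * k ≤ a * m' + (a ^ 2 - 1) * k' := fun {m' n' k'} h' => by
    have := Nat.find_min' hex ⟨m', n', k', h', (Int.toNat_of_nonneg (hpos h').le).symm⟩
    have h2 := hpos h'
    omega
  have ha1 : 0 < a ^ 2 - a - 1 := by nlinarith
  obtain ⟨d, rfl⟩ : ∃ d, b = a + d := ⟨b - a, by ring⟩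
  simp only [add_sub_cancel_left] at *
  have hd : 2 ≤ d := by omega
  have had : 0 < a * d - 1 := by nlinarith
  have i1 := hmin (hρ h)
  have i2 := hmin (hρ' h)
  have i3 := hmin (hη h)
  have i4 := hmin (hη' h)
  have i5 := hmin (hη (hρ h))
  have i6 := hmin (hρ' (hη' h))
  -- Beyond the facet spanned by `1` and `ρ (ρ - a) ^ 2`.
  by_cases hk : 0 < k
  · have hn : 0 < n := by
      by_contra! hn
      nlinarith [mul_pos ha1 hk, mul_nonneg had.le (neg_nonneg.2 hn)]
    exact ⟨m, n, k, h, .inl ⟨hk.le, hn.le, by nlinarith [mul_pos ha1 hk]⟩⟩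
  push Not at hk
  -- Beyond the facet spanned by `1` and `(ρ - a) ^ 2`.
  by_cases hC : a * n + k < 0
  · have hB : 0 ≤ m + a * k := by
      by_contra! hB
      nlinarith [mul_pos ha1 (neg_pos.2 hB)]
    have hn : 0 ≤ n := by
      by_contra! hn
      nlinarith [mul_nonneg (mul_nonneg (by omega : 0 ≤ a) (by omega : 0 ≤ d)) (neg_nonneg.2 hk),
        mul_pos (by nlinarith : 0 < a * d ^ 2 + a ^ 2 * d - d) (neg_pos.2 hn)]
    have hn' : 0 ≤ k + (a + d) * n := by
      by_contra! hn'
      nlinarith [mul_pos (by nlinarith : 0 < a * d) (neg_pos.2 hn'),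
        mul_nonneg (by omega : 0 ≤ d) hn]
    exact ⟨_, _, _, hρ h, .inl ⟨hB, hn', by linarith⟩⟩
  push Not at hC
  by_cases hA : a * n + k ≤ d * a * (m + a * k)
  · exact ⟨m, n, k, h, .inr ⟨hk, hC, hA⟩⟩
  -- Beyond the facet spanned by `(ρ - a) ^ 2` and `ρ (ρ - a) ^ 2`.
  push Not at hA
  generalize hm₂ : n - d * (m + a * k) = m₂ at *
  generalize hn₂ : k + a * m₂ = n₂ at *
  generalize hk₂ : m + a * k - d * n₂ = k₂ at *
  have hn : 0 < n₂ := by rw [← hn₂, ← hm₂]; linarith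
  have hT : a * m + (a ^ 2 - 1) * k = a * k₂ + (a * d - 1) * n₂ + a * m₂ := by
    subst hk₂ hn₂ hm₂; ring
  have hB : 0 < k₂ := by
    by_contra! hB
    nlinarith [mul_pos had hn, mul_nonneg ha1.le (neg_nonneg.2 hB)]
  refine ⟨_, _, _, hη' h, .inl ⟨?_, ?_, ?_⟩⟩ <;> simp only [hm₂, hn₂, hk₂]
  · exact hB.le
  · exact hn.le
  · have : 0 ≤ d * (m₂ - a * n₂) := by linarith
    have := nonneg_of_mul_nonneg_right this (by omega)
    nlinarith

/-! ### Indecomposable elements of the two cones -/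

section

variable {K : Type*} [Field K]

theorem _root_.IsTotallyPositive.of_mul_eq_one {u w : K} (huw : u * w = 1)
    (hu : IsTotallyPositive u) : IsTotallyPositive w := fun σ =>
  pos_of_mul_pos_right (a := σ u) (by simp [← map_mul, huw]) (hu σ).le

theorem _root_.IsIndecomposableIn.unit_mul {O : Subalgebra ℤ K} {u w α : K}
    (h : IsIndecomposableIn O α) (hu : u ∈ O) (hw : w ∈ O) (huw : u * w = 1)
    (hpos : IsTotallyPositive u) : IsIndecomposableIn O (u * α) := by
  have hwpos : IsTotallyPositive w := .of_mul_eq_one huw hpos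
  have hmul : ∀ {x y : K}, IsTotallyPositive x → IsTotallyPositive y → IsTotallyPositive (x * y) :=
    fun hx hy σ => by rw [map_mul]; exact mul_pos (hx σ) (hy σ)
  refine ⟨mul_mem hu h.1, hmul hpos h.2.1, ?_⟩
  rintro ⟨β, hβ, γ, hγ, hβp, hγp, e⟩
  refine h.2.2 ⟨w * β, mul_mem hw hβ, w * γ, mul_mem hw hγ, hmul hwpos hβp, hmul hwpos hγp, ?_⟩
  linear_combination w * e - α * huw

variable {a b : ℤ} {ρ : K}

theorem pos_of_root (ha : 2 ≤ a) (hab : a ≤ b - 2) {r : ℝ}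
    (hr : r * (r - a) * (r - b) = 1) : 0 < r := by
  have ha' : (2 : ℝ) ≤ a := by exact_mod_cast ha
  have hab' : (a : ℝ) ≤ b - 2 := by exact_mod_cast hab
  by_contra! h
  have := mul_nonneg (mul_nonneg (neg_nonneg.2 h) (by linarith : 0 ≤ a - r))
    (by linarith : 0 ≤ b - r)
  linarith

theorem map_root (h : ρ * (ρ - a) * (ρ - b) = 1) (σ : K →+* ℝ) :
    σ ρ * (σ ρ - a) * (σ ρ - b) = 1 := by
  simpa using congrArg σ h

theorem sub_sq_pos {r : ℝ} (hr : r * (r - a) * (r - b) = 1) : 0 < (r - a) ^ 2 := by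
  refine sq_pos_of_ne_zero fun h0 => ?_
  simp [h0] at hr

/-- Nonzero elements of the cone spanned by `1, ρ, ρ (ρ - a) ^ 2` are totally positive. -/
theorem isTotallyPositive_of_mem_cone_rho (ha : 2 ≤ a) (hab : a ≤ b - 2)
    (h : ρ * (ρ - a) * (ρ - b) = 1) {m n k : ℤ} (hk : 0 ≤ k) (hn : 0 ≤ n)
    (hm : n ≤ (b - a) * m) (h0 : ¬(m = 0 ∧ n = 0 ∧ k = 0)) :
    IsTotallyPositive (elt a ρ m n k) := by
  intro σ
  rw [map_elt]
  have hr := map_root h σ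
  have hpos := pos_of_root ha hab hr
  have hη := sub_sq_pos hr
  have hd : (0 : ℝ) < b - a := by exact_mod_cast (by omega : 0 < b - a)
  have hm' : (0 : ℝ) ≤ (b - a) * m - n := by exact_mod_cast (by omega : 0 ≤ (b - a) * m - n)
  have hk' : (0 : ℝ) ≤ k := by exact_mod_cast hk
  have hn' : (0 : ℝ) ≤ n := by exact_mod_cast hn
  refine pos_of_mul_pos_right (a := (b - a : ℝ)) ?_ hd.le
  have e : (b - a) * elt a (σ ρ) m n k =
      ((b - a) * m - n) + (b - a) * k * σ ρ + n * (σ ρ * (σ ρ - a) ^ 2) := by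
    unfold elt
    linear_combination (-n : ℝ) * hr
  rw [e]
  have h1 : 0 < (b - a) * m - n ∨ 0 < k ∨ 0 < n := by
    by_contra! hc
    obtain rfl : k = 0 := by omega
    obtain rfl : n = 0 := by omega
    rcases mul_eq_zero.1 (by omega : (b - a) * m = 0) with h | h <;> omega
  rcases h1 with h1 | h1 | h1
  · have : (0 : ℝ) < (b - a) * m - n := by exact_mod_cast h1
    positivity
  · have : (0 : ℝ) < k := by exact_mod_cast h1
    positivity
  · have : (0 : ℝ) < n := by exact_mod_cast h1
    positivity

/-- Nonzero elements of the cone spanned by `1, (ρ - a) ^ 2, ρ (ρ - a) ^ 2` are totally positive. -/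
theorem isTotallyPositive_of_mem_cone_eta (ha : 2 ≤ a) (hab : a ≤ b - 2)
    (h : ρ * (ρ - a) * (ρ - b) = 1) {m n k : ℤ} (hk : k ≤ 0) (hn : 0 ≤ a * n + k)
    (hm : a * n + k ≤ (b - a) * a * (m + a * k)) (h0 : ¬(m = 0 ∧ n = 0 ∧ k = 0)) :
    IsTotallyPositive (elt a ρ m n k) := by
  intro σ
  rw [map_elt]
  have hr := map_root h σ
  have hpos := pos_of_root ha hab hr
  have hη := sub_sq_pos hr
  have hd : (0 : ℝ) < b - a := by exact_mod_cast (by omega : 0 < b - a)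
  have ha' : (0 : ℝ) < a := by exact_mod_cast (by omega : 0 < a)
  have hm' : (0 : ℝ) ≤ (b - a) * a * (m + a * k) - (a * n + k) := by
    exact_mod_cast (by omega : 0 ≤ (b - a) * a * (m + a * k) - (a * n + k))
  have hk' : (0 : ℝ) ≤ -k := by exact_mod_cast (by omega : 0 ≤ -k)
  have hn' : (0 : ℝ) ≤ a * n + k := by exact_mod_cast hn
  refine pos_of_mul_pos_right (a := ((b - a) * a : ℝ)) ?_ (by positivity)
  have e : (b - a) * a * elt a (σ ρ) m n k =
      ((b - a) * a * (m + a * k) - (a * n + k)) + (b - a) * (-k) * (σ ρ - a) ^ 2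
        + (a * n + k) * (σ ρ * (σ ρ - a) ^ 2) := by
    unfold elt
    linear_combination (-(a * n + k) : ℝ) * hr
  rw [e]
  have h1 : 0 < (b - a) * a * (m + a * k) - (a * n + k) ∨ 0 < -k ∨ 0 < a * n + k := by
    by_contra! hc
    obtain rfl : k = 0 := by omega
    have h2 : a * n = 0 := by omega
    have h3 : (b - a) * a * m = 0 := by simp only [mul_zero, add_zero] at *; omega
    have h4 : (b - a) * a ≠ 0 := mul_ne_zero (by omega) (by omega)
    have h5 := (mul_eq_zero.1 h2).resolve_left (by omega)
    have h6 := (mul_eq_zero.1 h3).resolve_left h4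
    exact h0 ⟨h6, h5, rfl⟩
  rcases h1 with h1 | h1 | h1
  · have : (0 : ℝ) < (b - a) * a * (m + a * k) - (a * n + k) := by exact_mod_cast h1
    positivity
  · have : (0 : ℝ) < -k := by exact_mod_cast h1
    positivity
  · have : (0 : ℝ) < a * n + k := by exact_mod_cast h1
    positivity

theorem coords_ne_zero_of_isIndecomposableIn {O : Subalgebra ℤ K} {m n k : ℤ}
    (hind : IsIndecomposableIn O (elt a ρ m n k)) : ¬(m = 0 ∧ n = 0 ∧ k = 0) := by
  rintro ⟨rfl, rfl, rfl⟩
  exact hind.2.2 ⟨_, hind.1, _, hind.1, hind.2.1, hind.2.1, by simp [elt]⟩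

/-- An indecomposable element from which a totally positive one can be subtracted, leaving zero or a
totally positive element, is equal to the latter. -/
theorem coords_eq_of_isIndecomposableIn (h : ρ * (ρ - a) * (ρ - b) = 1) {m n k m' n' k' : ℤ}
    (hind : IsIndecomposableIn (Algebra.adjoin ℤ {ρ}) (elt a ρ m n k))
    (h' : IsTotallyPositive (elt a ρ m' n' k'))
    (hsub : ¬(m - m' = 0 ∧ n - n' = 0 ∧ k - k' = 0) →
      IsTotallyPositive (elt a ρ (m - m') (n - n') (k - k'))) :
    m = m' ∧ n = n' ∧ k = k' := by
  by_contra hne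
  refine hind.2.2 ⟨_, (mem_adjoin_iff h).2 ⟨_, _, _, rfl⟩, _, (mem_adjoin_iff h).2 ⟨_, _, _, rfl⟩,
    h', hsub (by omega), ?_⟩
  rw [← elt_sub]; ring

/-- The indecomposables in the cone spanned by `1, ρ, ρ (ρ - a) ^ 2` are among `ρ` and the points
`1 + n θ` of the edge from `1` to `ρ (ρ - a) ^ 2`: subtract a generator whenever the result stays in
the cone. -/
theorem coords_of_mem_cone_rho (ha : 2 ≤ a) (hab : a ≤ b - 2)
    (h : ρ * (ρ - a) * (ρ - b) = 1) {m n k : ℤ} (hk : 0 ≤ k) (hn : 0 ≤ n)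
    (hm : n ≤ (b - a) * m)
    (hind : IsIndecomposableIn (Algebra.adjoin ℤ {ρ}) (elt a ρ m n k)) :
    (m = 0 ∧ n = 0 ∧ k = 1) ∨ (m = 1 ∧ n ≤ b - a ∧ k = 0) := by
  have hcone := @isTotallyPositive_of_mem_cone_rho K _ a b ρ ha hab h
  have hsub : ∀ {m' n' k' : ℤ}, (0 ≤ k' ∧ 0 ≤ n' ∧ n' ≤ (b - a) * m') →
      ¬(m' = 0 ∧ n' = 0 ∧ k' = 0) → (0 ≤ k - k' ∧ 0 ≤ n - n' ∧ n - n' ≤ (b - a) * (m - m')) →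
      m = m' ∧ n = n' ∧ k = k' := fun h1 h2 h3 =>
    coords_eq_of_isIndecomposableIn h hind (hcone h1.1 h1.2.1 h1.2.2 h2)
      (hcone h3.1 h3.2.1 h3.2.2)
  rcases hk.eq_or_lt with rfl | hk
  · right
    have hm1 : 1 ≤ m := by
      by_contra! hm0
      have : (b - a) * m ≤ 0 := mul_nonpos_of_nonneg_of_nonpos (by omega) (by omega)
      have h1 : n = 0 := by omega
      have h2 : m = 0 := by
        have : (b - a) * m = 0 := by omega
        exact (mul_eq_zero.1 this).resolve_left (by omega)
      exact coords_ne_zero_of_isIndecomposableIn hind ⟨h2, h1, rfl⟩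
    by_cases h1 : n ≤ (b - a) * (m - 1)
    · have := hsub (m' := 1) (n' := 0) (k' := 0) (by omega) (by omega) (by omega)
      omega
    · by_cases h2 : b - a ≤ n
      · have e : (b - a) * (m - 1) = (b - a) * m - (b - a) := by ring
        have := hsub (m' := 1) (n' := b - a) (k' := 0) (by omega) (by omega) (by omega)
        omega
      · have : (b - a) * (m - 1) < (b - a) * 1 := by omega
        have := lt_of_mul_lt_mul_left this (by omega)
        omega
  · left
    exact hsub (m' := 0) (n' := 0) (k' := 1) (by simp) (by simp)
      ⟨by omega, by simpa using hn, by simpa using hm⟩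

/-- The indecomposables in the cone spanned by `1, (ρ - a) ^ 2, ρ (ρ - a) ^ 2` are among
`(ρ - a) ^ 2` and the lattice points of the parallelepiped of the three generators, with `j = -k`. -/
theorem coords_of_mem_cone_eta (ha : 2 ≤ a) (hab : a ≤ b - 2)
    (h : ρ * (ρ - a) * (ρ - b) = 1) {m n k : ℤ} (hk : k ≤ 0) (hn : 0 ≤ a * n + k)
    (hm : a * n + k ≤ (b - a) * a * (m + a * k))
    (hind : IsIndecomposableIn (Algebra.adjoin ℤ {ρ}) (elt a ρ m n k)) :
    (m = a ^ 2 ∧ n = 1 ∧ k = -a) ∨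
      (-k ≤ a - 1 ∧ 0 ≤ n ∧ n ≤ b - a ∧ (n = 0 → k = 0) ∧ m = 1 + -k * a) := by
  have hcone := @isTotallyPositive_of_mem_cone_eta K _ a b ρ ha hab h
  have hsub : ∀ {m' n' k' : ℤ},
      (k' ≤ 0 ∧ 0 ≤ a * n' + k' ∧ a * n' + k' ≤ (b - a) * a * (m' + a * k')) →
      ¬(m' = 0 ∧ n' = 0 ∧ k' = 0) →
      (k - k' ≤ 0 ∧ 0 ≤ a * (n - n') + (k - k') ∧
        a * (n - n') + (k - k') ≤ (b - a) * a * (m - m' + a * (k - k'))) →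
      m = m' ∧ n = n' ∧ k = k' := fun h1 h2 h3 =>
    coords_eq_of_isIndecomposableIn h hind (hcone h1.1 h1.2.1 h1.2.2 h2)
      (hcone h3.1 h3.2.1 h3.2.2)
  have hd : 0 < (b - a) * a := mul_pos (by omega) (by omega)
  -- If one of the three coordinates on the generators is at least `1`, that generator can be
  -- subtracted: first `(ρ - a) ^ 2`, then `1`, then `ρ (ρ - a) ^ 2`.
  by_cases hka : k ≤ -a
  · left
    exact hsub ⟨by omega, by omega, by nlinarith⟩ (by omega)
      ⟨by omega, by linarith, by linarith [mul_comm a (k - -a)]⟩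
  right
  have hn0 : 0 ≤ n := by
    by_contra! hn0
    nlinarith
  have hs : 0 ≤ m + a * k := by
    by_contra! hs
    nlinarith
  by_cases hA : a * n + k ≤ (b - a) * a * (m - 1 + a * k)
  · obtain ⟨rfl, rfl, rfl⟩ := hsub (m' := 1) (n' := 0) (k' := 0) ⟨by omega, by omega, by nlinarith⟩
      (by omega) ⟨by omega, by simpa using hn, by simpa using hA⟩
    omega
  by_cases hC : (b - a) * a ≤ a * n + k
  · obtain ⟨rfl, rfl, rfl⟩ := hsub (m' := 1) (n' := b - a) (k' := 0)
      ⟨by omega, by nlinarith, by nlinarith⟩ (by omega) ⟨by omega, by linarith, by linarith⟩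
    omega
  push Not at hA hC hka
  have hs1 : m + a * k ≤ 1 := by
    by_contra! hs1
    nlinarith
  have hs2 : m + a * k ≠ 0 := fun hs0 => by
    rw [hs0, mul_zero] at hm
    have h1 : k = -(a * n) := by omega
    have h2 : n = 0 := by
      by_contra! h2
      have : 1 ≤ n := by omega
      nlinarith
    subst h2
    obtain rfl : k = 0 := by simpa using h1
    exact coords_ne_zero_of_isIndecomposableIn hind ⟨by simpa using hs0, rfl, rfl⟩
  refine ⟨by omega, hn0, ?_, ?_, by linarith [mul_comm a k, (by omega : m + a * k = 1)]⟩
  · by_contra! hnd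
    nlinarith
  · rintro rfl
    omega

/-! ### Norms of indecomposables -/

/-- Totally positive units are covered by `j = n = 0`, where `parNorm` is `1`. -/
theorem exists_norm_eq_parNorm [NumberField K] (ha : 2 ≤ a) (hab : a ≤ b - 2)
    (h : ρ * (ρ - a) * (ρ - b) = 1) (hK : IntermediateField.adjoin ℚ {ρ} = ⊤) {α : K}
    (hα : IsIndecomposableIn (Algebra.adjoin ℤ {ρ}) α) :
    ∃ j n : ℤ, 0 ≤ j ∧ j ≤ a - 1 ∧ 0 ≤ n ∧ n ≤ b - a ∧ (n = 0 → j = 0) ∧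
      Algebra.norm ℚ α = parNorm a (b - a) j n := by
  obtain ⟨r, hr, h01, h0, h1, h2, h1b, h2b⟩ := exists_roots ha hab
  choose σ hσ using fun i => exists_ringHom ha hab h hK (hr i)
  have hN := norm_elt ha hab h hK
  -- Indecomposability and the norm are both unchanged by totally positive units of norm `1`.
  let P : ℤ → ℤ → ℤ → Prop := fun m n k =>
    IsIndecomposableIn (Algebra.adjoin ℤ {ρ}) (elt a ρ m n k) ∧
      Algebra.norm ℚ (elt a ρ m n k) = Algebra.norm ℚ α
  have hunit : ∀ {u w : K} {m n k m' n' k' : ℤ}, P m n k → u ∈ Algebra.adjoin ℤ {ρ} →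
      w ∈ Algebra.adjoin ℤ {ρ} → u * w = 1 → IsTotallyPositive u → Algebra.norm ℚ u = 1 →
      u * elt a ρ m n k = elt a ρ m' n' k' → P m' n' k' := by
    intro u w m n k m' n' k' hP hu hw huw hpos hnu e
    refine ⟨e ▸ hP.1.unit_mul hu hw huw hpos, ?_⟩
    rw [← e, map_mul, hnu, one_mul, hP.2]
  have hρ1 : ρ * ((ρ - a) * (ρ - b)) = 1 := by rw [← h]; ring
  have hη1 : (ρ - a) ^ 2 * (ρ * (ρ - b)) ^ 2 = 1 := by
    rw [← mul_pow, show (ρ - a) * (ρ * (ρ - b)) = 1 by rw [← h]; ring, one_pow]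
  have hρO : ρ ∈ Algebra.adjoin ℤ {ρ} := Algebra.self_mem_adjoin_singleton ℤ ρ
  have haO : ρ - a ∈ Algebra.adjoin ℤ {ρ} := sub_mem hρO (intCast_mem _ a)
  have hbO : ρ - b ∈ Algebra.adjoin ℤ {ρ} := sub_mem hρO (intCast_mem _ b)
  have hρpos : IsTotallyPositive ρ := fun τ => pos_of_root ha hab (map_root h τ)
  have hηpos : IsTotallyPositive ((ρ - a) ^ 2) := fun τ => by
    simpa using sub_sq_pos (map_root h τ)
  have hNinv : ∀ {u w : K}, u * w = 1 → Algebra.norm ℚ u = 1 → Algebra.norm ℚ w = 1 :=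
    fun {u w} huw hu => by simpa [hu] using congrArg (Algebra.norm ℚ) huw
  have hρN : Algebra.norm ℚ ρ = 1 := by
    have := hN 0 0 1
    rw [show elt a ρ 0 0 1 = ρ by simp [elt]] at this
    rw [this]; norm_num
  have hηN : Algebra.norm ℚ ((ρ - a) ^ 2) = 1 := by
    have := hN (a ^ 2) 1 (-a)
    rw [show elt a ρ (a ^ 2) 1 (-a) = (ρ - a) ^ 2 by simp [elt]; ring] at this
    rw [this]; push_cast; ring
  obtain ⟨m, n, k, ⟨hind, hnorm⟩, hC⟩ := exists_mem_cone ha hab (P := P)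
    (fun hP => hunit hP hρO (mul_mem haO hbO) hρ1 hρpos hρN (rho_mul_elt h ..))
    (fun hP => hunit hP (mul_mem haO hbO) hρO (by rw [mul_comm, hρ1])
      (.of_mul_eq_one hρ1 hρpos) (hNinv hρ1 hρN) (rho_inv_mul_elt h ..))
    (fun hP => hunit hP (pow_mem haO 2) (pow_mem (mul_mem hρO hbO) 2) hη1 hηpos hηN
      (by rw [sq, mul_assoc, rho_sub_mul_elt h, rho_sub_mul_elt h]))
    (fun hP => hunit hP (pow_mem (mul_mem hρO hbO) 2) (pow_mem haO 2) (by rw [mul_comm, hη1])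
      (.of_mul_eq_one hη1 hηpos) (hNinv hη1 hηN)
      (by rw [sq, mul_assoc, rho_sub_inv_mul_elt h, rho_sub_inv_mul_elt h]))
    (fun {m n k} hP => height_pos hr h01 h0 h1 h2 h1b h2b fun i => by
      rw [← hσ, ← map_elt]; exact hP.1.2.1 (σ i))
    (by
      obtain ⟨m, n, k, rfl⟩ := (mem_adjoin_iff h).1 hα.1
      exact ⟨m, n, k, hα, rfl⟩)
  rw [← hnorm, hN]
  rcases hC with ⟨hk, hn, hm⟩ | ⟨hk, hn, hm⟩
  · obtain ⟨rfl, rfl, rfl⟩ | ⟨rfl, hnd, rfl⟩ := coords_of_mem_cone_rho ha hab h hk hn hm hind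
    · exact ⟨0, 0, by omega, by omega, by omega, by omega, by simp, by simp [parNorm]⟩
    · refine ⟨0, n, by omega, by omega, hn, hnd, by simp, ?_⟩
      congr 1; unfold parNorm; ring
  · obtain ⟨rfl, rfl, rfl⟩ | ⟨hka, hn0, hnd, hnk, rfl⟩ :=
      coords_of_mem_cone_eta ha hab h hk hn hm hind
    · refine ⟨0, 0, by omega, by omega, by omega, by omega, by simp, ?_⟩
      congr 1; unfold parNorm; ring
    · refine ⟨-k, n, by omega, hka, hn0, hnd, by omega, ?_⟩
      congr 1; unfold parNorm; ring

end

end ThomasCubic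

theorem mainTheorem8 {K : Type*} [Field K] [NumberField K] (a b L l₀ : ℤ)
    (ha : 2 ≤ a) (hab : a ≤ b - 2) (hne : (a, b) ≠ (2, 4))
    (hl₀ : l₀ = 0 ∨ l₀ = 1) (hL : b - a = 2 * L + l₀)
    (ρ : K) (hρ : aeval ρ (thomasPoly a b) = 0) (hK : IntermediateField.adjoin ℚ {ρ} = ⊤)
    (α : K) (hα : IsIndecomposableIn (Algebra.adjoin ℤ {ρ}) α) :
    (l₀ = 0 → 1 ≤ L → L ≤ a - 2 →
      Algebra.norm ℚ α ≤
        ((L ^ 2 * a ^ 3 + (2 * L ^ 3 + L ^ 2 + 1) * a ^ 2 - (2 * L ^ 3 + 3 * L ^ 2 + L) * a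
          + L ^ 3 + L ^ 2 : ℤ) : ℚ)) ∧
    (l₀ = 1 → 1 ≤ L → L ≤ a + 1 →
      Algebra.norm ℚ α ≤
        (((L ^ 2 + L) * a ^ 3 + (2 * L ^ 3 + 4 * L ^ 2 + 3 * L + 3) * a ^ 2
          - (2 * L ^ 3 + 6 * L ^ 2 + 5 * L + 3) * a + L ^ 3 + 3 * L ^ 2 + 2 * L + 1 : ℤ) : ℚ)) := by
  rw [ThomasCubic.aeval_thomasPoly, sub_eq_zero] at hρ
  obtain ⟨j, n, hj, hja, hn, hnd, h0, hN⟩ := ThomasCubic.exists_norm_eq_parNorm ha hab hρ hK hα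
  rw [hN, hL]
  rw [hL] at hnd
  have hone : ∀ d, ThomasCubic.parNorm a d 0 0 = 1 := fun d => by simp [ThomasCubic.parNorm]
  refine ⟨fun hl h1 h2 => ?_, fun hl h1 h2 => ?_⟩ <;> subst hl <;> norm_cast
  · rw [add_zero] at hnd ⊢
    rcases hn.eq_or_lt with rfl | hn
    · rw [h0 rfl, hone]
      obtain ⟨p, rfl⟩ : ∃ p : ℕ, a = L + 2 + p := ⟨(a - L - 2).toNat, by omega⟩
      obtain ⟨q, rfl⟩ : ∃ q : ℕ, L = 1 + q := ⟨(L - 1).toNat, by omega⟩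
      rw [← sub_nonneg]
      ring_nf
      positivity
    · exact ThomasCubic.parNorm_le_even h1 h2 hj hja hn hnd
  · rcases hn.eq_or_lt with rfl | hn
    · rw [h0 rfl, hone]
      obtain ⟨p, rfl⟩ : ∃ p : ℕ, a = 2 + p := ⟨(a - 2).toNat, by omega⟩
      obtain ⟨q, rfl⟩ : ∃ q : ℕ, L = 1 + q := ⟨(L - 1).toNat, by omega⟩
      rw [← sub_nonneg]
      ring_nf
      positivity
    · exact ThomasCubic.parNorm_le_odd ha h1 h2 hj hja hn hnd
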